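/- Let $k\ge 1$ be an integer and let $\rho>0$. Let $S^k(\rho)\subset\mathbb{R}^{k+1}$ be the Euclidean sphere of radius $\rho$ centred at the origin, with surface measure $dS_u$. For a point $m\in\mathbb{R}^{k+1}$ with $0<|m|=\eta<\rho$ and for $\alpha\in\mathbb{R}$ put $$F(\alpha)=\int_{S^k(\rho)}\omega(u,m)^{\alpha}\,dS_u,\qquad \omega(u,m)=\frac{|u|^2-|m|^2}{|u-m|^2}.$$ For $\lambda<0$ let $\varphi_\lambda:[0,\infty)\to\mathbb{R}$ be the radial eigenfunction, equal to $1$ at the origin, of the Laplacian of the $(k+1)$-dimensional hyperbolic space of constant sectional curvature $-1/\rho^2$, written in the geodesic distance $r$ from the origin; that is, the unique function that is continuous on $[0,\infty)$, twice differentiable on $(0,\infty)$, and satisfies $$\varphi_\lambda''(r)+\frac{k}{\rho}\coth\Big(\frac r\rho\Big)\varphi_\lambda'(r)+\lambda\,\varphi_\lambda(r)=0\quad(r>0),\qquad \varphi_\lambda(0)=1 .$$ (Such a function exists and is unique for every $\lambda<0$.) Here $f\sim g$ means $f-g=o(g)$. **Theorem.** For every such $m$, as $s\to+\infty$ and also as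 $s\to-\infty$, $$F\Big(\frac k2+s\Big)\sim\left(\frac{\pi\rho(\rho^2-\eta^2)}{\eta|s|}\right)^{k/2}\left(\frac{\rho+\eta}{\rho-\eta}\right)^{|s|}.$$ Equivalently, in terms of the radial eigenfunctions: for every fixed $r>0$, as $\lambda\to-\infty$, $$\varphi_\lambda(r)\sim\left(\frac 2\rho\right)^{k/2}\frac{\Gamma\left(\frac{k+1}{2}\right)}{2\sqrt{\pi}\,\sinh^{k/2}(r/\rho)}\cdot\frac{e^{r\sqrt{-\lambda}}}{(-\lambda)^{k/4}}.$$ -/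

import Mathlib

open MeasureTheory

/-- The surface measure of the Euclidean sphere `S^k(ρ)` of radius `ρ > 0` centred at the origin of
`ℝ^{k+1}`, as a measure on `ℝ^{k+1}`: the image of the surface measure of the unit sphere under
`v ↦ ρ v`, multiplied by `ρ ^ k`. -/
noncomputable def sphereMeasure (k : ℕ) (ρ : ℝ) :
    Measure (EuclideanSpace ℝ (Fin (k + 1))) :=
  ENNReal.ofReal (ρ ^ k) •
    Measure.map
      (fun v : Metric.sphere (0 : EuclideanSpace ℝ (Fin (k + 1))) 1 =>
        ρ • (v : EuclideanSpace ℝ (Fin (k + 1))))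
      (volume : Measure (EuclideanSpace ℝ (Fin (k + 1)))).toSphere

/-- The normalized Poisson kernel `ω(u, m) = (|u|² - |m|²) / |u - m|²`. -/
noncomputable def poissonOmega {k : ℕ} (u m : EuclideanSpace ℝ (Fin (k + 1))) : ℝ :=
  (‖u‖ ^ 2 - ‖m‖ ^ 2) / ‖u - m‖ ^ 2

/-- `F(α) = ∫_{S^k(ρ)} ω(u, m)^α dS_u`, for a point `m` with `|m| < ρ`. -/
noncomputable def sphereIntegral (k : ℕ) (ρ : ℝ) (m : EuclideanSpace ℝ (Fin (k + 1)))
    (α : ℝ) : ℝ :=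
  ∫ u, poissonOmega u m ^ α ∂(sphereMeasure k ρ)

/-- `φ` (a function of the geodesic distance `r ≥ 0` to the origin) is a radial eigenfunction, with
eigenvalue `lam` and with value `1` at the origin, of the Laplacian of the hyperbolic space of
dimension `k + 1` and constant sectional curvature `-1/ρ²`: it solves
`φ'' + (k/ρ) coth(r/ρ) φ' + lam φ = 0` for `r > 0`, is continuous up to `r = 0`, and `φ(0) = 1`. -/
structure IsRadialEigenfunction (k : ℕ) (ρ lam : ℝ) (φ : ℝ → ℝ) : Prop where
  continuousOn : ContinuousOn φ (Set.Ici 0)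
  map_zero : φ 0 = 1
  differentiableAt : ∀ r, 0 < r → DifferentiableAt ℝ φ r
  differentiableAt_deriv : ∀ r, 0 < r → DifferentiableAt ℝ (deriv φ) r
  ode : ∀ r, 0 < r →
    deriv (deriv φ) r + (k / ρ) * (Real.cosh (r / ρ) / Real.sinh (r / ρ)) * deriv φ r
      + lam * φ r = 0

/-!
In curvature `-1`, at hyperbolic distance `x` from the origin, the power `ω ^ α` of the Poisson
kernel is the horospherical wave `expBusemann x θ ^ (-α)`, an eigenfunction of the Laplacian with
eigenvalue `α (k - α)`. As `ω` depends only on the angle `θ` between `u` and `m`, the integral over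
the sphere reduces to an integral over `θ ∈ [0, π]` with weight `sin θ ^ (k - 1)`. Being an average
of waves, it solves the radial eigenvalue equation. Solutions continuous at the origin are unique up
to scaling: the quotient by a positive solution `φ` has derivative `const / (sinh ^ k * φ ^ 2)`,
which is integrable at `0` only when the constant vanishes. So the integral is a multiple of
`φ_lam`, and it is invariant under `α ↦ k - α`, that is, under `s ↦ -s`. As `s → +∞` the integrand
concentrates where `expBusemann` is smallest, at `θ = 0`, and Laplace's method gives both asymptotic
formulas; in the second one `s = √(k ^ 2 / 4 - lam ρ ^ 2) = ρ √(-lam) + o(1)`.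
-/

section PolarCoordinates

open Set Metric

variable {E : Type*} [NormedAddCommGroup E] [NormedSpace ℝ E] [MeasurableSpace E] [BorelSpace E]
  [FiniteDimensional ℝ E] [Nontrivial E]

theorem lintegral_eq_lintegral_toSphere (μ : Measure E) [μ.IsAddHaarMeasure] {g : E → ENNReal}
    (hg : Measurable g) :
    ∫⁻ x, g x ∂μ = ∫⁻ u : sphere (0 : E) 1, (∫⁻ r in Ioi (0 : ℝ),
      ENNReal.ofReal (r ^ (Module.finrank ℝ E - 1)) * g (r • (u : E))) ∂μ.toSphere := by
  have hg' : Measurable fun p : sphere (0 : E) 1 × Ioi (0 : ℝ) => g ((p.2 : ℝ) • (p.1 : E)) :=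
    hg.comp (by fun_prop)
  calc
    ∫⁻ x, g x ∂μ = ∫⁻ x : ({0}ᶜ : Set E), g x.1 ∂(μ.comap (↑)) := by
      rw [lintegral_subtype_comap (measurableSet_singleton _).compl g, restrict_compl_singleton]
    _ = ∫⁻ p : sphere (0 : E) 1 × Ioi (0 : ℝ), g ((p.2 : ℝ) • (p.1 : E))
          ∂μ.toSphere.prod (.volumeIoiPow (Module.finrank ℝ E - 1)) := by
      rw [← μ.measurePreserving_homeomorphUnitSphereProd.lintegral_comp_emb
        (Homeomorph.measurableEmbedding _)]
      refine lintegral_congr fun x => ?_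
      have hx : ‖(x : E)‖ ≠ 0 := norm_ne_zero_iff.2 x.2
      simp [smul_smul, hx]
    _ = ∫⁻ u : sphere (0 : E) 1, ∫⁻ r : Ioi (0 : ℝ), g ((r : ℝ) • (u : E))
          ∂(Measure.volumeIoiPow (Module.finrank ℝ E - 1)) ∂μ.toSphere :=
      lintegral_prod _ hg'.aemeasurable
    _ = _ := by
      refine lintegral_congr fun u => ?_
      have hm : Measurable fun r : Ioi (0 : ℝ) => g ((r : ℝ) • (u : E)) := hg.comp (by fun_prop)
      rw [Measure.volumeIoiPow, lintegral_withDensity_eq_lintegral_mul _ (by fun_prop) hm]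
      exact lintegral_subtype_comap measurableSet_Ioi
        (fun r : ℝ => ENNReal.ofReal (r ^ (Module.finrank ℝ E - 1)) * g (r • (u : E)))

theorem lintegral_comp_norm (μ : Measure E) [μ.IsAddHaarMeasure] {h : ℝ → ENNReal}
    (hh : Measurable h) :
    ∫⁻ x, h ‖x‖ ∂μ = μ.toSphere univ * ∫⁻ r in Ioi (0 : ℝ),
      ENNReal.ofReal (r ^ (Module.finrank ℝ E - 1)) * h r := by
  rw [lintegral_eq_lintegral_toSphere μ (g := fun x => h ‖x‖) (hh.comp measurable_norm), mul_comm,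
    ← lintegral_const]
  refine lintegral_congr fun u => setLIntegral_congr_fun measurableSet_Ioi fun r (hr : 0 < r) => ?_
  simp [norm_smul, abs_of_pos hr]

theorem polarCoord_symm_preimage_upperHalfPlane_inter_target :
    polarCoord.symm ⁻¹' (univ ×ˢ Ioi 0) ∩ polarCoord.target = Ioi 0 ×ˢ Ioo 0 Real.pi := by
  ext ⟨r, θ⟩
  simp only [polarCoord_target, mem_inter_iff, mem_preimage, polarCoord_symm_apply, mem_prod,
    mem_univ, true_and, mem_Ioi, mem_Ioo]
  constructor
  · rintro ⟨hsin, hr, hθ⟩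
    have hθ₀ : 0 < θ := by
      by_contra! h
      exact (Real.sin_nonpos_of_nonpos_of_neg_pi_le h hθ.1.le).not_gt
        (pos_of_mul_pos_right hsin hr.le)
    exact ⟨hr, hθ₀, hθ.2⟩
  · rintro ⟨hr, hθ⟩
    exact ⟨mul_pos hr (Real.sin_pos_of_pos_of_lt_pi hθ.1 hθ.2), hr, by linarith [hθ.1, hθ.2], hθ.2⟩

theorem setLIntegral_upperHalfPlane_eq_polar {H : ℝ × ℝ → ENNReal} (hH : Measurable H) :
    ∫⁻ p in univ ×ˢ Ioi (0 : ℝ), H p = ∫⁻ θ in Ioo 0 Real.pi, ∫⁻ r in Ioi (0 : ℝ),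
      ENNReal.ofReal r * H (r * Real.cos θ, r * Real.sin θ) := by
  have hU : MeasurableSet ((univ : Set ℝ) ×ˢ Ioi (0 : ℝ)) :=
    MeasurableSet.univ.prod measurableSet_Ioi
  have hsymm : Measurable polarCoord.symm := by
    simp only [funext polarCoord_symm_apply]
    fun_prop
  calc
    ∫⁻ p in univ ×ˢ Ioi 0, H p = ∫⁻ p, (univ ×ˢ Ioi 0).indicator H p :=
      (lintegral_indicator hU H).symm
    _ = ∫⁻ p in polarCoord.target,
          ENNReal.ofReal p.1 • (univ ×ˢ Ioi 0).indicator H (polarCoord.symm p) :=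
      (lintegral_comp_polarCoord_symm _).symm
    _ = ∫⁻ p in polarCoord.target, (polarCoord.symm ⁻¹' (univ ×ˢ Ioi 0)).indicator
          (fun p => ENNReal.ofReal p.1 * H (polarCoord.symm p)) p := by
      refine lintegral_congr fun p => ?_
      simp [indicator]
    _ = ∫⁻ p in Ioi 0 ×ˢ Ioo 0 Real.pi, ENNReal.ofReal p.1 * H (polarCoord.symm p) := by
      rw [lintegral_indicator (hsymm hU), Measure.restrict_restrict (hsymm hU),
        polarCoord_symm_preimage_upperHalfPlane_inter_target]
    _ = _ := by
      rw [Measure.volume_eq_prod, ← Measure.prod_restrict, lintegral_prod_symm]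
      · simp only [polarCoord_symm_apply]
      · exact ((by fun_prop : Measurable fun p : ℝ × ℝ => ENNReal.ofReal p.1).mul
          (hH.comp hsymm)).aemeasurable

end PolarCoordinates

section ZonalIntegration

open Set Metric InnerProductGeometry

theorem lintegral_euclideanSpace_succ (n : ℕ) {g : ℝ → ℝ → ENNReal}
    (hg : Measurable (Function.uncurry g)) :
    ∫⁻ x : EuclideanSpace ℝ (Fin (n + 1)), g (x 0) ‖x‖ =
      ∫⁻ t : ℝ, ∫⁻ y : EuclideanSpace ℝ (Fin n), g t √(t ^ 2 + ‖y‖ ^ 2) := by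
  have hnorm (x : EuclideanSpace ℝ (Fin (n + 1))) :
      ‖x‖ = √(x 0 ^ 2 + ‖WithLp.toLp 2 (fun i : Fin n => x i.succ)‖ ^ 2) := by
    rw [EuclideanSpace.norm_sq_eq, EuclideanSpace.norm_eq, Fin.sum_univ_succ]
    simp
  let G : ℝ × (Fin n → ℝ) → ENNReal := fun p => g p.1 √(p.1 ^ 2 + ‖WithLp.toLp 2 p.2‖ ^ 2)
  have hG : Measurable G :=
    hg.comp (by fun_prop : Measurable fun p : ℝ × (Fin n → ℝ) =>
      (p.1, √(p.1 ^ 2 + ‖WithLp.toLp 2 p.2‖ ^ 2)))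
  let split := MeasurableEquiv.piFinSuccAbove (fun _ : Fin (n + 1) => ℝ) 0
  calc
    ∫⁻ x : EuclideanSpace ℝ (Fin (n + 1)), g (x 0) ‖x‖
      = ∫⁻ x : EuclideanSpace ℝ (Fin (n + 1)), G (split (WithLp.ofLp x)) :=
        lintegral_congr fun x => by rw [hnorm x]; rfl
    _ = ∫⁻ z : Fin (n + 1) → ℝ, G (split z) :=
        (PiLp.volume_preserving_ofLp (Fin (n + 1))).lintegral_comp (hG.comp split.measurable)
    _ = ∫⁻ p : ℝ × (Fin n → ℝ), G p :=
        (volume_preserving_piFinSuccAbove (fun _ : Fin (n + 1) => ℝ) 0).lintegral_comp hG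
    _ = ∫⁻ t : ℝ, ∫⁻ y : Fin n → ℝ, G (t, y) := lintegral_prod _ hG.aemeasurable
    _ = _ := lintegral_congr fun t =>
        ((PiLp.volume_preserving_ofLp (Fin n)).lintegral_comp
          (hG.comp measurable_prodMk_left)).symm

theorem lintegral_euclideanSpace_eq_polar (n : ℕ) {g : ℝ → ℝ → ENNReal}
    (hg : Measurable (Function.uncurry g)) :
    ∫⁻ x : EuclideanSpace ℝ (Fin (n + 2)), g (x 0) ‖x‖ =
      (volume : Measure (EuclideanSpace ℝ (Fin (n + 1)))).toSphere univ *
        ∫⁻ θ in Ioo 0 Real.pi, ∫⁻ r in Ioi (0 : ℝ),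
          ENNReal.ofReal (r ^ (n + 1) * Real.sin θ ^ n) * g (r * Real.cos θ) r := by
  let H : ℝ × ℝ → ENNReal := fun p => ENNReal.ofReal (p.2 ^ n) * g p.1 √(p.1 ^ 2 + p.2 ^ 2)
  have hH : Measurable H := by
    have : Measurable fun p : ℝ × ℝ => g p.1 √(p.1 ^ 2 + p.2 ^ 2) :=
      hg.comp (by fun_prop : Measurable fun p : ℝ × ℝ => (p.1, √(p.1 ^ 2 + p.2 ^ 2)))
    fun_prop
  have hinner (t : ℝ) : ∫⁻ y : EuclideanSpace ℝ (Fin (n + 1)), g t √(t ^ 2 + ‖y‖ ^ 2) =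
      (volume : Measure (EuclideanSpace ℝ (Fin (n + 1)))).toSphere univ *
        ∫⁻ s in Ioi (0 : ℝ), H (t, s) := by
    have hgt : Measurable fun s : ℝ => g t √(t ^ 2 + s ^ 2) :=
      hg.comp (by fun_prop : Measurable fun s : ℝ => (t, √(t ^ 2 + s ^ 2)))
    simpa only [finrank_euclideanSpace_fin, Nat.add_sub_cancel] using
      lintegral_comp_norm (volume : Measure (EuclideanSpace ℝ (Fin (n + 1)))) hgt
  rw [lintegral_euclideanSpace_succ (n + 1) hg, lintegral_congr hinner,
    lintegral_const_mul' _ _ (measure_ne_top _ _)]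
  congr 1
  calc
    ∫⁻ t : ℝ, ∫⁻ s in Ioi (0 : ℝ), H (t, s) = ∫⁻ p in univ ×ˢ Ioi (0 : ℝ), H p := by
      rw [Measure.volume_eq_prod, ← Measure.prod_restrict, Measure.restrict_univ,
        lintegral_prod _ hH.aemeasurable]
    _ = _ := setLIntegral_upperHalfPlane_eq_polar hH
    _ = _ := by
      refine setLIntegral_congr_fun measurableSet_Ioo fun θ _ =>
        setLIntegral_congr_fun measurableSet_Ioi fun r (hr : 0 < r) => ?_
      have hnorm : √((r * Real.cos θ) ^ 2 + (r * Real.sin θ) ^ 2) = r := by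
        rw [mul_pow, mul_pow, ← mul_add, Real.cos_sq_add_sin_sq, mul_one, Real.sqrt_sq hr.le]
      simp only [H, hnorm]
      rw [← mul_assoc, ← ENNReal.ofReal_mul hr.le]
      ring_nf

theorem lintegral_comp_inner_norm {n : ℕ} {e : EuclideanSpace ℝ (Fin (n + 1))} (he : ‖e‖ = 1)
    {g : ℝ → ℝ → ENNReal} (hg : Measurable (Function.uncurry g)) :
    ∫⁻ x : EuclideanSpace ℝ (Fin (n + 1)), g (inner ℝ e x) ‖x‖ =
      ∫⁻ x : EuclideanSpace ℝ (Fin (n + 1)), g (x 0) ‖x‖ := by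
  let e₀ : EuclideanSpace ℝ (Fin (n + 1)) := EuclideanSpace.single 0 1
  let T := (ℝ ∙ (e - e₀))ᗮ.reflection
  have hT : T e = e₀ := Submodule.reflection_sub (by simp [he, e₀])
  have hm : Measurable fun x : EuclideanSpace ℝ (Fin (n + 1)) => g (x 0) ‖x‖ :=
    hg.comp (by fun_prop : Measurable fun x : EuclideanSpace ℝ (Fin (n + 1)) => (x 0, ‖x‖))
  rw [← T.measurePreserving.lintegral_comp hm]
  refine lintegral_congr fun x => ?_
  have hcoord : T x 0 = inner ℝ e x := by
    rw [← T.inner_map_map, hT]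
    simp [e₀, EuclideanSpace.inner_single_left]
  rw [hcoord, T.norm_map]

theorem lintegral_Ioi_pow_mul_exp_neg (n : ℕ) :
    ∫⁻ r in Ioi (0 : ℝ), ENNReal.ofReal (r ^ n) * ENNReal.ofReal (Real.exp (-r)) =
      ENNReal.ofReal n.factorial := by
  have hint := Real.GammaIntegral_convergent (s := n + 1) (by positivity)
  rw [← Real.Gamma_nat_eq_factorial, Real.Gamma_eq_integral (by positivity),
    ofReal_integral_eq_lintegral_ofReal hint]
  · refine setLIntegral_congr_fun measurableSet_Ioi fun r (hr : 0 < r) => ?_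
    simp only [add_sub_cancel_right, Real.rpow_natCast]
    rw [← ENNReal.ofReal_mul (by positivity), mul_comm]
  · filter_upwards [ae_restrict_mem measurableSet_Ioi] with r (hr : 0 < r)
    positivity

@[fun_prop]
theorem measurable_angle_right {E : Type*} [NormedAddCommGroup E] [InnerProductSpace ℝ E]
    [MeasurableSpace E] [OpensMeasurableSpace E] (e : E) : Measurable fun x => angle e x := by
  unfold angle
  fun_prop

theorem lintegral_comp_angle_mul_comp_norm {E : Type*} [NormedAddCommGroup E]
    [InnerProductSpace ℝ E] [MeasurableSpace E] [BorelSpace E] [FiniteDimensional ℝ E]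
    [Nontrivial E] (μ : Measure E) [μ.IsAddHaarMeasure] (e : E) {f w : ℝ → ENNReal}
    (hf : Measurable f) (hw : Measurable w) :
    ∫⁻ x, f (angle e x) * w ‖x‖ ∂μ =
      (∫⁻ u : sphere (0 : E) 1, f (angle e u) ∂μ.toSphere) *
        ∫⁻ r in Ioi (0 : ℝ), ENNReal.ofReal (r ^ (Module.finrank ℝ E - 1)) * w r := by
  rw [lintegral_eq_lintegral_toSphere μ (by fun_prop), ← lintegral_mul_const _ (by fun_prop)]
  refine lintegral_congr fun u => ?_
  rw [← lintegral_const_mul _ (by fun_prop)]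
  refine setLIntegral_congr_fun measurableSet_Ioi fun r (hr : 0 < r) => ?_
  simp only [norm_smul, norm_eq_of_mem_sphere, mul_one, Real.norm_eq_abs, abs_of_pos hr,
    angle_smul_right_of_pos _ _ hr]
  ring

theorem lintegral_toSphere_comp_angle {n : ℕ} {e : EuclideanSpace ℝ (Fin (n + 2))} (he : e ≠ 0)
    {f : ℝ → ENNReal} (hf : Measurable f) :
    ∫⁻ u : sphere (0 : EuclideanSpace ℝ (Fin (n + 2))) 1, f (angle e u)
        ∂(volume : Measure (EuclideanSpace ℝ (Fin (n + 2)))).toSphere =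
      (volume : Measure (EuclideanSpace ℝ (Fin (n + 1)))).toSphere univ *
        ∫⁻ θ in Ioo 0 Real.pi, ENNReal.ofReal (Real.sin θ ^ n) * f θ := by
  -- Integrate the zonal function `f (angle e x)` against the weight `exp (-‖x‖)` over the whole
  -- space in two ways; the radial integrals are the same nonzero constant.
  let W : ℝ → ENNReal := fun r => ENNReal.ofReal (Real.exp (-r))
  let c : ENNReal := ENNReal.ofReal (n + 1).factorial
  have hc : ∫⁻ r in Ioi (0 : ℝ), ENNReal.ofReal (r ^ (n + 1)) * W r = c :=
    lintegral_Ioi_pow_mul_exp_neg (n + 1)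
  have hc_top : c ≠ ⊤ := ENNReal.ofReal_ne_top
  have hc_zero : c ≠ 0 := by simp [c, Nat.factorial_ne_zero]
  have hangle (x : EuclideanSpace ℝ (Fin (n + 2))) :
      angle e x = Real.arccos (inner ℝ (‖e‖⁻¹ • e) x / ‖x‖) := by
    rw [angle, real_inner_smul_left, div_mul_eq_div_div, div_eq_inv_mul (inner ℝ e x)]
  have hunit : ‖‖e‖⁻¹ • e‖ = 1 := norm_smul_inv_norm he
  have hzonal : ∫⁻ x, f (angle e x) * W ‖x‖ =
      (volume : Measure (EuclideanSpace ℝ (Fin (n + 1)))).toSphere univ *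
        (∫⁻ θ in Ioo 0 Real.pi, ENNReal.ofReal (Real.sin θ ^ n) * f θ) * c := by
    have hg : Measurable (Function.uncurry fun t r : ℝ => f (Real.arccos (t / r)) * W r) := by
      simp only [Function.uncurry_def]
      fun_prop
    simp only [hangle]
    rw [lintegral_comp_inner_norm hunit hg,
      lintegral_euclideanSpace_eq_polar n hg, mul_assoc, ← lintegral_mul_const' _ _ hc_top]
    congr 1
    refine setLIntegral_congr_fun measurableSet_Ioo fun θ hθ => ?_
    rw [← hc, ← lintegral_const_mul _ (by fun_prop)]
    refine setLIntegral_congr_fun measurableSet_Ioi fun r (hr : 0 < r) => ?_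
    simp only [mul_div_cancel_left₀ _ hr.ne', Real.arccos_cos hθ.1.le hθ.2.le,
      ENNReal.ofReal_mul (pow_nonneg hr.le (n + 1))]
    ring
  have hpolar := lintegral_comp_angle_mul_comp_norm volume e hf (w := W) (by fun_prop)
  rw [finrank_euclideanSpace_fin, show n + 2 - 1 = n + 1 from rfl, hc] at hpolar
  exact (ENNReal.mul_left_inj hc_zero hc_top).1 (hpolar.symm.trans hzonal)

theorem map_angle_toSphere {n : ℕ} {e : EuclideanSpace ℝ (Fin (n + 2))} (he : e ≠ 0) :
    (volume : Measure (EuclideanSpace ℝ (Fin (n + 2)))).toSphere.map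
        (fun u : sphere (0 : EuclideanSpace ℝ (Fin (n + 2))) 1 => angle e u) =
      (volume : Measure (EuclideanSpace ℝ (Fin (n + 1)))).toSphere univ •
        (volume.restrict (Ioo 0 Real.pi)).withDensity fun θ => ENNReal.ofReal (Real.sin θ ^ n) := by
  refine Measure.ext_of_lintegral _ fun f hf => ?_
  rw [lintegral_map hf (by fun_prop), lintegral_toSphere_comp_angle he hf,
    lintegral_smul_measure, lintegral_withDensity_eq_lintegral_mul _ (by fun_prop) hf]
  rfl

theorem integral_toSphere_comp_angle {n : ℕ} {e : EuclideanSpace ℝ (Fin (n + 2))} (he : e ≠ 0)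
    {f : ℝ → ℝ} (hf : Measurable f) :
    ∫ u : sphere (0 : EuclideanSpace ℝ (Fin (n + 2))) 1, f (angle e u)
        ∂(volume : Measure (EuclideanSpace ℝ (Fin (n + 2)))).toSphere =
      (volume : Measure (EuclideanSpace ℝ (Fin (n + 1)))).toSphere.real univ *
        ∫ θ in (0 : ℝ)..Real.pi, f θ * Real.sin θ ^ n := by
  rw [← integral_map (φ := fun u : sphere (0 : EuclideanSpace ℝ (Fin (n + 2))) 1 => angle e u)
      (by fun_prop) hf.aestronglyMeasurable,
    map_angle_toSphere he, integral_smul_measure, smul_eq_mul, Measure.real,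
    integral_withDensity_eq_integral_toReal_smul (by fun_prop) (by simp),
    intervalIntegral.integral_of_le Real.pi_pos.le, integral_Ioc_eq_integral_Ioo]
  congr 1
  refine setIntegral_congr_fun measurableSet_Ioo fun θ hθ => ?_
  have hsin : 0 ≤ Real.sin θ ^ n := pow_nonneg (Real.sin_pos_of_pos_of_lt_pi hθ.1 hθ.2).le n
  simp only [ENNReal.toReal_ofReal hsin, smul_eq_mul, mul_comm]

theorem toSphere_real_univ_euclideanSpace (ι : Type*) [Fintype ι] [Nonempty ι] :
    (volume : Measure (EuclideanSpace ℝ ι)).toSphere.real univ =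
      2 * Real.pi ^ ((Fintype.card ι : ℝ) / 2) / Real.Gamma ((Fintype.card ι : ℝ) / 2) := by
  have hπ : √Real.pi ^ Fintype.card ι = Real.pi ^ ((Fintype.card ι : ℝ) / 2) := by
    rw [Real.sqrt_eq_rpow, ← Real.rpow_natCast, ← Real.rpow_mul Real.pi_pos.le, one_div_mul_eq_div]
  rw [Measure.toSphere_real_apply_univ, Measure.real, EuclideanSpace.volume_ball,
    ENNReal.ofReal_one, one_pow, one_mul, finrank_euclideanSpace,
    Real.Gamma_add_one (by positivity), hπ, ENNReal.toReal_ofReal (by positivity)]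
  field_simp

theorem integral_sin_pow_eq_Gamma (n : ℕ) :
    ∫ θ in (0 : ℝ)..Real.pi, Real.sin θ ^ n =
      √Real.pi * Real.Gamma (((n : ℝ) + 1) / 2) / Real.Gamma (((n : ℝ) + 2) / 2) := by
  have hπ : Real.pi ^ (((n : ℝ) + 2) / 2) = Real.pi ^ (((n : ℝ) + 1) / 2) * √Real.pi := by
    rw [Real.sqrt_eq_rpow, ← Real.rpow_add Real.pi_pos]
    ring_nf
  have harea := integral_toSphere_comp_angle (n := n)
    (e := EuclideanSpace.single 0 1) (by simp) (f := fun _ => 1) measurable_const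
  simp only [integral_const, smul_eq_mul, mul_one, one_mul, toSphere_real_univ_euclideanSpace,
    Fintype.card_fin, Nat.cast_add, Nat.cast_ofNat, Nat.cast_one, hπ] at harea
  field_simp at harea ⊢
  linear_combination -harea

end ZonalIntegration

section ExpBusemann

open Real InnerProductGeometry

/-- The exponential of the Busemann function of hyperbolic space based at an ideal point `ξ`,
evaluated at the point at distance `x` from the origin in a direction making the angle `θ` with `ξ`.
In the ball model this is the reciprocal of the normalized Poisson kernel. -/
noncomputable def expBusemann (x θ : ℝ) : ℝ :=
  cosh x - sinh x * cos θ

theorem exp_neg_abs_le_expBusemann (x θ : ℝ) : exp (-|x|) ≤ expBusemann x θ := by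
  have hsinh : sinh x * cos θ ≤ |sinh x| := by
    refine (le_abs_self _).trans ?_
    rw [abs_mul]
    exact mul_le_of_le_one_right (abs_nonneg _) (abs_cos_le_one θ)
  rw [← cosh_sub_sinh |x|, cosh_abs, ← abs_sinh, expBusemann]
  linarith

theorem expBusemann_pos (x θ : ℝ) : 0 < expBusemann x θ :=
  (exp_pos _).trans_le (exp_neg_abs_le_expBusemann x θ)

theorem continuous_expBusemann : Continuous fun p : ℝ × ℝ => expBusemann p.1 p.2 := by
  unfold expBusemann
  fun_prop

theorem continuous_expBusemann_rpow (β : ℝ) :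
    Continuous fun p : ℝ × ℝ => expBusemann p.1 p.2 ^ β :=
  continuous_expBusemann.rpow_const fun p => .inl (expBusemann_pos p.1 p.2).ne'

theorem continuous_expBusemann_rpow_right (β x : ℝ) : Continuous fun θ => expBusemann x θ ^ β :=
  (continuous_expBusemann_rpow β).comp (by fun_prop : Continuous fun θ : ℝ => (x, θ))

theorem hasDerivAt_expBusemann_left (x θ : ℝ) :
    HasDerivAt (expBusemann · θ) (sinh x - cosh x * cos θ) x :=
  (hasDerivAt_cosh x).sub ((hasDerivAt_sinh x).mul_const _)

theorem hasDerivAt_expBusemann_right (x θ : ℝ) :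
    HasDerivAt (expBusemann x) (sinh x * sin θ) θ :=
  (((hasDerivAt_cos θ).const_mul (sinh x)).const_sub (cosh x)).congr_deriv (by ring)

theorem sq_sinh_sub_cosh_mul_cos (x θ : ℝ) :
    (sinh x - cosh x * cos θ) ^ 2 = expBusemann x θ ^ 2 - sin θ ^ 2 := by
  rw [expBusemann]
  linear_combination (cos θ ^ 2 - 1) * cosh_sq x + sin_sq_add_cos_sq θ

theorem expBusemann_rpow_sub_one (β x θ : ℝ) :
    expBusemann x θ ^ (β - 1) = expBusemann x θ ^ (β - 2) * expBusemann x θ := by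
  rw [← rpow_add_one (expBusemann_pos x θ).ne']
  ring_nf

theorem expBusemann_rpow (β x θ : ℝ) :
    expBusemann x θ ^ β = expBusemann x θ ^ (β - 2) * expBusemann x θ ^ 2 := by
  rw [← rpow_natCast, ← rpow_add (expBusemann_pos x θ)]
  norm_num

theorem hasDerivAt_expBusemann_rpow (β x θ : ℝ) :
    HasDerivAt (fun y => expBusemann y θ ^ β)
      (β * expBusemann x θ ^ (β - 1) * (sinh x - cosh x * cos θ)) x :=
  ((hasDerivAt_expBusemann_left x θ).rpow_const (.inl (expBusemann_pos x θ).ne')).congr_deriv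
    (by ring)

theorem hasDerivAt_deriv_expBusemann_rpow (β x θ : ℝ) :
    HasDerivAt (fun y => β * expBusemann y θ ^ (β - 1) * (sinh y - cosh y * cos θ))
      (β ^ 2 * expBusemann x θ ^ β - β * (β - 1) * expBusemann x θ ^ (β - 2) * sin θ ^ 2) x := by
  have hslope : HasDerivAt (fun y => sinh y - cosh y * cos θ) (expBusemann x θ) x :=
    (hasDerivAt_sinh x).sub ((hasDerivAt_cosh x).mul_const _)
  refine (((hasDerivAt_expBusemann_rpow (β - 1) x θ).const_mul β).mul hslope).congr_deriv ?_
  rw [show β - 1 - 1 = β - 2 by ring, expBusemann_rpow_sub_one β, expBusemann_rpow β]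
  linear_combination β * (β - 1) * expBusemann x θ ^ (β - 2) * sq_sinh_sub_cosh_mul_cos x θ

theorem hasDerivAt_expBusemann_rpow_mul_sin_pow (n : ℕ) (β x θ : ℝ) :
    HasDerivAt (fun θ => expBusemann x θ ^ β * sin θ ^ (n + 1))
      (β * expBusemann x θ ^ (β - 1) * sinh x * sin θ ^ (n + 2) +
        (n + 1) * expBusemann x θ ^ β * sin θ ^ n * cos θ) θ := by
  refine (((hasDerivAt_expBusemann_right x θ).rpow_const (.inl (expBusemann_pos x θ).ne')).mul
    ((hasDerivAt_sin θ).pow (n + 1))).congr_deriv ?_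
  simp only [Pi.pow_apply, Nat.add_sub_cancel, Nat.cast_add, Nat.cast_one]
  ring

theorem poissonOmega_smul {n : ℕ} {ρ : ℝ} {m u : EuclideanSpace ℝ (Fin (n + 1))} (hm : ‖m‖ < ρ)
    (hu : ‖u‖ = 1) :
    poissonOmega (ρ • u) m = (expBusemann (log ((ρ + ‖m‖) / (ρ - ‖m‖))) (angle m u))⁻¹ := by
  have hρ : 0 < ρ := (norm_nonneg m).trans_lt hm
  have hsub : 0 < ρ - ‖m‖ := sub_pos.2 hm
  have hcosine : ‖ρ • u - m‖ ^ 2 = ρ ^ 2 + ‖m‖ ^ 2 - 2 * (ρ * ‖m‖ * cos (angle m u)) := by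
    rw [norm_sub_sq_real, real_inner_smul_left, real_inner_comm, norm_smul, hu, mul_one,
      Real.norm_eq_abs, sq_abs, ← cos_angle_mul_norm_mul_norm m u, hu]
    ring
  rw [poissonOmega, hcosine, expBusemann, cosh_log (by positivity), sinh_log (by positivity),
    norm_smul, hu, mul_one, Real.norm_eq_abs, sq_abs, ← inv_div, inv_div (ρ + ‖m‖)]
  congr 1
  rw [show ρ ^ 2 - ‖m‖ ^ 2 = (ρ + ‖m‖) * (ρ - ‖m‖) by ring]
  field_simp
  ring

end ExpBusemann

section LegendreIntegral

open Real Set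

/-- The average (up to normalization) over the sphere at infinity `S^(n+1)` of the horospherical
waves `expBusemann ^ (-α)`, as a function of the distance `x` to the origin of `(n+2)`-dimensional
hyperbolic space. It is a multiple of an associated Legendre function of `cosh x`. -/
noncomputable def legendreIntegral (n : ℕ) (α x : ℝ) : ℝ :=
  ∫ θ in (0 : ℝ)..π, expBusemann x θ ^ (-α) * sin θ ^ n

theorem sphereIntegral_eq_legendreIntegral {n : ℕ} {ρ : ℝ} {m : EuclideanSpace ℝ (Fin (n + 2))}
    (hm₀ : m ≠ 0) (hm : ‖m‖ < ρ) (α : ℝ) :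
    sphereIntegral (n + 1) ρ m α =
      ρ ^ (n + 1) * ((volume : Measure (EuclideanSpace ℝ (Fin (n + 1)))).toSphere.real univ *
        legendreIntegral n α (log ((ρ + ‖m‖) / (ρ - ‖m‖)))) := by
  have hρ : 0 < ρ := (norm_nonneg m).trans_lt hm
  have hmeas (x : ℝ) : Measurable fun θ => expBusemann x θ ^ (-α) :=
    (continuous_expBusemann_rpow_right (-α) x).measurable
  rw [legendreIntegral, ← integral_toSphere_comp_angle hm₀ (hmeas _), sphereIntegral,
    sphereMeasure, integral_smul_measure, ENNReal.toReal_ofReal (by positivity), smul_eq_mul,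
    integral_map (by fun_prop)]
  · congr 1
    refine integral_congr_ae (.of_forall fun u => ?_)
    simp only
    rw [poissonOmega_smul hm (norm_eq_of_mem_sphere u), rpow_neg (expBusemann_pos _ _).le,
      inv_rpow (expBusemann_pos _ _).le]
  · unfold poissonOmega
    exact (by fun_prop : Measurable _).aestronglyMeasurable

theorem legendreIntegral_zero (n : ℕ) (α : ℝ) :
    legendreIntegral n α 0 = √π * Gamma (((n : ℝ) + 1) / 2) / Gamma (((n : ℝ) + 2) / 2) := by
  simp [legendreIntegral, expBusemann, integral_sin_pow_eq_Gamma]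

theorem legendreIntegral_pos (n : ℕ) (α x : ℝ) : 0 < legendreIntegral n α x := by
  have hcont := continuous_expBusemann_rpow_right (-α) x
  refine intervalIntegral.intervalIntegral_pos_of_pos_on
    (Continuous.intervalIntegrable (by fun_prop) _ _) (fun θ hθ => ?_) pi_pos
  exact mul_pos (rpow_pos_of_pos (expBusemann_pos x θ) _)
    (pow_pos (sin_pos_of_pos_of_lt_pi hθ.1 hθ.2) n)

theorem hasDerivAt_intervalIntegral_of_continuous {F F' : ℝ → ℝ → ℝ}
    (hF : ∀ x, Continuous (F x)) (hF' : Continuous (Function.uncurry F'))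
    (h : ∀ x t, HasDerivAt (F · t) (F' x t) x) (a b x₀ : ℝ) :
    HasDerivAt (fun x => ∫ t in a..b, F x t) (∫ t in a..b, F' x₀ t) x₀ := by
  obtain ⟨C, hC⟩ := ((isCompact_Icc (a := x₀ - 1) (b := x₀ + 1)).prod
    (isCompact_uIcc (a := a) (b := b))).exists_bound_of_continuousOn hF'.continuousOn
  refine (intervalIntegral.hasDerivAt_integral_of_dominated_loc_of_deriv_le (F' := F')
    (bound := fun _ => C) (Icc_mem_nhds (sub_one_lt x₀) (lt_add_one x₀))
    (.of_forall fun x => (hF x).aestronglyMeasurable) ((hF x₀).intervalIntegrable _ _) ?_ ?_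
    intervalIntegrable_const ?_).2
  · exact (hF'.comp (by fun_prop : Continuous fun t : ℝ => (x₀, t))).aestronglyMeasurable
  · exact .of_forall fun t ht x hx => hC (x, t) ⟨hx, uIoc_subset_uIcc ht⟩
  · exact .of_forall fun t _ x _ => h x t

theorem hasDerivAt_legendreIntegral (n : ℕ) (α x : ℝ) :
    HasDerivAt (legendreIntegral n α) (∫ θ in (0 : ℝ)..π,
      -α * expBusemann x θ ^ (-α - 1) * (sinh x - cosh x * cos θ) * sin θ ^ n) x := by
  refine hasDerivAt_intervalIntegral_of_continuous (fun x => ?_) ?_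
    (fun x θ => (hasDerivAt_expBusemann_rpow (-α) x θ).mul_const (sin θ ^ n)) 0 π x
  · have := continuous_expBusemann_rpow_right (-α) x
    fun_prop
  · have := continuous_expBusemann_rpow (-α - 1)
    simp only [Function.uncurry_def]
    fun_prop

theorem hasDerivAt_deriv_legendreIntegral (n : ℕ) (α x : ℝ) :
    HasDerivAt (deriv (legendreIntegral n α)) (∫ θ in (0 : ℝ)..π,
      ((-α) ^ 2 * expBusemann x θ ^ (-α) -
        -α * (-α - 1) * expBusemann x θ ^ (-α - 2) * sin θ ^ 2) * sin θ ^ n) x := by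
  rw [funext fun y => (hasDerivAt_legendreIntegral n α y).deriv]
  refine hasDerivAt_intervalIntegral_of_continuous (fun x => ?_) ?_
    (fun x θ => (hasDerivAt_deriv_expBusemann_rpow (-α) x θ).mul_const (sin θ ^ n)) 0 π x
  · have := continuous_expBusemann_rpow_right (-α - 1) x
    fun_prop
  · have := continuous_expBusemann_rpow (-α)
    have := continuous_expBusemann_rpow (-α - 2)
    simp only [Function.uncurry_def]
    fun_prop

theorem legendreIntegral_ode (n : ℕ) (α : ℝ) {x : ℝ} (hx : x ≠ 0) :
    deriv (deriv (legendreIntegral n α)) x +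
      (n + 1) * (cosh x / sinh x) * deriv (legendreIntegral n α) x +
      α * (n + 1 - α) * legendreIntegral n α x = 0 := by
  have hsinh : sinh x ≠ 0 := sinh_eq_zero.not.2 hx
  have hcont₀ := continuous_expBusemann_rpow_right (-α) x
  have hcont₁ := continuous_expBusemann_rpow_right (-α - 1) x
  have hcont₂ := continuous_expBusemann_rpow_right (-α - 2) x
  have hboundary := intervalIntegral.integral_eq_sub_of_hasDerivAt (a := 0) (b := π)
    (fun θ _ => (hasDerivAt_expBusemann_rpow_mul_sin_pow n (-α - 1) x θ).const_mul (α / sinh x))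
    (Continuous.intervalIntegrable (by
      rw [show -α - 1 - 1 = -α - 2 by ring]
      fun_prop) _ _)
  rw [(hasDerivAt_deriv_legendreIntegral n α x).deriv, (hasDerivAt_legendreIntegral n α x).deriv,
    legendreIntegral, ← intervalIntegral.integral_const_mul, ← intervalIntegral.integral_const_mul,
    ← intervalIntegral.integral_add, ← intervalIntegral.integral_add]
  · -- The waves satisfy the ODE up to a total `θ`-derivative, which integrates to zero.
    refine (intervalIntegral.integral_congr fun θ _ => ?_).trans (hboundary.trans (by simp))
    rw [show -α - 1 - 1 = -α - 2 by ring, expBusemann_rpow_sub_one (-α), expBusemann_rpow (-α)]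
    set P := expBusemann x θ ^ (-α - 2)
    have hsq := cosh_sq x
    simp only [expBusemann]
    field_simp
    linear_combination α * P * sin θ ^ n * (n + 1) * (cosh x - sinh x * cos θ) * cos θ * hsq
  all_goals exact Continuous.intervalIntegrable (by fun_prop) _ _

theorem isRadialEigenfunction_legendreIntegral {n : ℕ} {ρ lam α : ℝ} (hρ : ρ ≠ 0)
    (hα : α * (n + 1 - α) = lam * ρ ^ 2) :
    IsRadialEigenfunction (n + 1) ρ lam
      (fun r => legendreIntegral n α (r / ρ) / legendreIntegral n α 0) := by
  set φ : ℝ → ℝ := fun r => legendreIntegral n α (r / ρ) / legendreIntegral n α 0 with hφ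
  have hscale (r : ℝ) : HasDerivAt (· / ρ) (1 / ρ) r := (hasDerivAt_id r).div_const ρ
  have hφ' (r : ℝ) : HasDerivAt φ
      (deriv (legendreIntegral n α) (r / ρ) * (1 / ρ) / legendreIntegral n α 0) r :=
    ((hasDerivAt_legendreIntegral n α (r / ρ)).differentiableAt.hasDerivAt.comp r
      (hscale r)).div_const _
  have hderiv : deriv φ = _ := funext fun r => (hφ' r).deriv
  have hφ'' (r : ℝ) : HasDerivAt (deriv φ) (deriv (deriv (legendreIntegral n α)) (r / ρ) *
      (1 / ρ) * (1 / ρ) / legendreIntegral n α 0) r := by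
    rw [hderiv]
    exact (((hasDerivAt_deriv_legendreIntegral n α (r / ρ)).differentiableAt.hasDerivAt.comp r
      (hscale r)).mul_const _).div_const _
  refine ⟨fun r _ => (hφ' r).continuousAt.continuousWithinAt, ?_,
    fun r _ => (hφ' r).differentiableAt, fun r _ => (hφ'' r).differentiableAt, fun r hr => ?_⟩
  · simp [hφ, (legendreIntegral_pos n α 0).ne']
  · have hode := legendreIntegral_ode n α (div_ne_zero hr.ne' hρ)
    rw [(hφ'' r).deriv, (hφ' r).deriv, hφ, (eq_div_iff (pow_ne_zero 2 hρ)).2 hα.symm]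
    push_cast
    linear_combination (1 / (ρ ^ 2 * legendreIntegral n α 0)) * hode

end LegendreIntegral

section Uniqueness

open Real Set Filter Topology Asymptotics

theorem eq_zero_of_hasDerivAt_const_div {q d : ℝ → ℝ} {w : ℝ} (hq : ContinuousOn q (Ici 0))
    (hd : ∀ r, 0 < r → 0 < d r) (hdO : d =O[𝓝[>] 0] id)
    (hderiv : ∀ r, 0 < r → HasDerivAt q (w / d r) r) : w = 0 := by
  by_contra hw
  have hint : IntegrableOn (fun r => w * (w / d r)) (Ioc 0 1) := by
    rw [← intervalIntegrable_iff_integrableOn_Ioc_of_le zero_le_one]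
    refine intervalIntegral.intervalIntegrable_deriv_of_nonneg (g := fun r => w * q r) ?_ ?_ ?_
    · rw [uIcc_of_le zero_le_one]
      exact continuousOn_const.mul (hq.mono Icc_subset_Ici_self)
    · exact fun r hr => (hderiv r (by simpa using hr.1)).const_mul w
    · intro r hr
      have := hd r (by simpa using hr.1)
      rw [← mul_div_assoc]
      exact div_nonneg (mul_self_nonneg w) this.le
  have hinv : (fun r : ℝ => r⁻¹) =O[𝓝[>] 0] fun r => w * (w / d r) := by
    have := (hdO.inv_rev (eventually_nhdsWithin_of_forall fun r hr h =>
      absurd h (hd r hr).ne')).const_mul_right (c := w * w) (mul_ne_zero hw hw)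
    exact this.congr_right fun r => by ring
  refine not_integrableOn_of_tendsto_norm_atTop_of_deriv_isBigO_filter (f := log) _
    (Ioc_mem_nhdsGT one_pos) ?_ (tendsto_abs_atBot_atTop.comp tendsto_log_nhdsGT_zero)
    (by simpa only [deriv_log'] using hinv) hint
  filter_upwards [self_mem_nhdsWithin] with r hr using differentiableAt_log hr.ne'

theorem IsRadialEigenfunction.hasDerivAt_wronskian {n : ℕ} {ρ lam : ℝ} {φ ψ : ℝ → ℝ}
    (hρ : ρ ≠ 0) (hφ : IsRadialEigenfunction (n + 1) ρ lam φ)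
    (hψ : IsRadialEigenfunction (n + 1) ρ lam ψ) {r : ℝ} (hr : 0 < r) :
    HasDerivAt (fun r => sinh (r / ρ) ^ (n + 1) * (deriv ψ r * φ r - ψ r * deriv φ r)) 0 r := by
  have hsinh : sinh (r / ρ) ≠ 0 := sinh_eq_zero.not.2 (div_ne_zero hr.ne' hρ)
  have hweight := ((hasDerivAt_id r).div_const ρ).sinh.fun_pow (n + 1)
  have hφ₁ := (hφ.differentiableAt r hr).hasDerivAt
  have hψ₁ := (hψ.differentiableAt r hr).hasDerivAt
  have hφ₂ := (hφ.differentiableAt_deriv r hr).hasDerivAt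
  have hψ₂ := (hψ.differentiableAt_deriv r hr).hasDerivAt
  refine (hweight.mul ((hψ₂.mul hφ₁).sub (hψ₁.mul hφ₂))).congr_deriv ?_
  have hode_φ : deriv (deriv φ) r = _ := eq_neg_of_add_eq_zero_left
    ((add_assoc _ _ _).symm.trans (hφ.ode r hr))
  have hode_ψ : deriv (deriv ψ) r = _ := eq_neg_of_add_eq_zero_left
    ((add_assoc _ _ _).symm.trans (hψ.ode r hr))
  simp only [Pi.sub_apply, Pi.mul_apply, id_eq, Nat.add_sub_cancel, hode_φ, hode_ψ]
  field_simp
  ring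

theorem IsRadialEigenfunction.isBigO_sinh_pow_mul_sq {n : ℕ} {ρ lam : ℝ} {φ : ℝ → ℝ}
    (hφ : IsRadialEigenfunction (n + 1) ρ lam φ) :
    (fun r => sinh (r / ρ) ^ (n + 1) * φ r ^ 2) =O[𝓝[>] 0] id := by
  have hsinh : (fun r => sinh (r / ρ)) =O[𝓝[>] 0] id := by
    simpa [Function.id_def] using
      (((hasDerivAt_id (0 : ℝ)).div_const ρ).sinh.isBigO_sub.mono nhdsWithin_le_nhds)
  have hbounded : (fun r => sinh (r / ρ) ^ n * φ r ^ 2) =O[𝓝[>] 0] fun _ => (1 : ℝ) :=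
    ((((continuous_sinh.comp (continuous_id.div_const ρ)).pow n).continuousOn.mul
      (hφ.continuousOn.pow 2) 0 self_mem_Ici).mono Ioi_subset_Ici_self).isBigO_one ℝ
  exact (hsinh.mul hbounded).congr (fun r => by ring) fun r => mul_one _

theorem IsRadialEigenfunction.eqOn {n : ℕ} {ρ lam : ℝ} {φ ψ : ℝ → ℝ} (hρ : 0 < ρ)
    (hφ : IsRadialEigenfunction (n + 1) ρ lam φ) (hψ : IsRadialEigenfunction (n + 1) ρ lam ψ)
    (hpos : ∀ r, 0 ≤ r → 0 < φ r) : EqOn ψ φ (Ici 0) := by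
  -- `(ψ / φ)' = W / d` with `W` constant; `1 / d` is not integrable at `0`, so `W = 0`.
  set W := fun r => sinh (r / ρ) ^ (n + 1) * (deriv ψ r * φ r - ψ r * deriv φ r) with hW
  set d := fun r => sinh (r / ρ) ^ (n + 1) * φ r ^ 2 with hd
  have hsinh (r : ℝ) (hr : 0 < r) : 0 < sinh (r / ρ) := sinh_pos_iff.2 (div_pos hr hρ)
  have hWconst (r : ℝ) (hr : 0 < r) : W r = W 1 :=
    isOpen_Ioi.is_const_of_deriv_eq_zero isPreconnected_Ioi
      (fun r hr => (hφ.hasDerivAt_wronskian hρ.ne' hψ hr).differentiableAt.differentiableWithinAt)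
      (fun r hr => (hφ.hasDerivAt_wronskian hρ.ne' hψ hr).deriv) hr (zero_lt_one' ℝ)
  have hquot : ContinuousOn (ψ / φ) (Ici 0) :=
    hψ.continuousOn.div hφ.continuousOn fun r hr => (hpos r hr).ne'
  have hderiv (r : ℝ) (hr : 0 < r) : HasDerivAt (ψ / φ) (W 1 / d r) r := by
    refine ((hψ.differentiableAt r hr).hasDerivAt.div (hφ.differentiableAt r hr).hasDerivAt
      (hpos r hr.le).ne').congr_deriv ?_
    have := (hsinh r hr).ne'
    have := (hpos r hr.le).ne'
    rw [← hWconst r hr, hW, hd]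
    field_simp
  have hW₁ : W 1 = 0 := eq_zero_of_hasDerivAt_const_div hquot
    (fun r hr => mul_pos (pow_pos (hsinh r hr) _) (pow_pos (hpos r hr.le) 2))
    hφ.isBigO_sinh_pow_mul_sq hderiv
  intro r hr
  obtain rfl | hr := (mem_Ici.1 hr).eq_or_lt
  · rw [hψ.map_zero, hφ.map_zero]
  obtain ⟨c, _, hslope⟩ := exists_hasDerivAt_eq_slope (ψ / φ) _ hr
    (hquot.mono Icc_subset_Ici_self) fun s hs => hderiv s hs.1
  rw [hW₁, zero_div, eq_comm, div_eq_zero_iff, sub_eq_zero, or_iff_left (sub_pos.2 hr).ne',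
    Pi.div_apply, Pi.div_apply, hψ.map_zero, hφ.map_zero, div_one,
    div_eq_one_iff_eq (hpos r hr.le).ne'] at hslope
  exact hslope

theorem IsRadialEigenfunction.eqOn_legendreIntegral {n : ℕ} {ρ lam α : ℝ} {ψ : ℝ → ℝ}
    (hρ : 0 < ρ) (hα : α * (n + 1 - α) = lam * ρ ^ 2)
    (hψ : IsRadialEigenfunction (n + 1) ρ lam ψ) :
    EqOn ψ (fun r => legendreIntegral n α (r / ρ) / legendreIntegral n α 0) (Ici 0) :=
  (isRadialEigenfunction_legendreIntegral hρ.ne' hα).eqOn hρ hψ fun _ _ =>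
    div_pos (legendreIntegral_pos _ _ _) (legendreIntegral_pos _ _ _)

theorem legendreIntegral_symm (n : ℕ) (α : ℝ) {x : ℝ} (hx : 0 ≤ x) :
    legendreIntegral n (n + 1 - α) x = legendreIntegral n α x := by
  have hψ : IsRadialEigenfunction (n + 1) 1 (α * (n + 1 - α)) _ :=
    isRadialEigenfunction_legendreIntegral (α := n + 1 - α) one_ne_zero (by ring)
  have heq := hψ.eqOn_legendreIntegral one_pos (α := α) (by ring) hx
  have hL₀ : legendreIntegral n (n + 1 - α) 0 = legendreIntegral n α 0 := by
    rw [legendreIntegral_zero, legendreIntegral_zero]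
  simpa only [div_one, hL₀, div_left_inj' (legendreIntegral_pos n α 0).ne'] using heq

end Uniqueness

section LaplaceMethod

open Real Set Filter Topology

theorem integral_rpow_mul_exp_neg_mul_sq {a p : ℝ} (ha : 0 < a) (hp : -1 < p) :
    ∫ v in Ioi (0 : ℝ), v ^ p * exp (-a * v ^ 2) =
      a ^ (-((p + 1) / 2)) / 2 * Gamma ((p + 1) / 2) := by
  have := integral_rpow_mul_exp_neg_mul_rpow two_pos hp ha
  simp only [rpow_two] at this
  rw [this, neg_div]
  ring

theorem rpow_mul_intervalIntegral_eq_setIntegral_Ioi (f : ℝ → ℝ) (p : ℝ) {b t : ℝ} (hb : 0 ≤ b)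
    (ht : 0 < t) :
    t ^ (p + 1) * ∫ θ in 0..b, f θ =
      ∫ v in Ioi (0 : ℝ), (Ioc 0 (t * b)).indicator (fun v => t ^ p * f (v / t)) v := by
  rw [setIntegral_indicator measurableSet_Ioc, inter_eq_right.2 Ioc_subset_Ioi_self,
    ← intervalIntegral.integral_of_le (by positivity), intervalIntegral.integral_const_mul,
    intervalIntegral.integral_comp_div _ ht.ne', zero_div, mul_div_cancel_left₀ _ ht.ne',
    rpow_add_one ht.ne', smul_eq_mul, mul_assoc]

variable {φ g : ℝ → ℝ} {p A B b c C : ℝ}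

theorem abs_rescaled_exp_neg_mul_le (hc : ∀ θ ∈ Ioc 0 b, c * θ ^ 2 ≤ φ θ)
    (hC : ∀ θ ∈ Ioc 0 b, |g θ| ≤ C * θ ^ p) {t v : ℝ} (ht : 0 < t) (hv : v ∈ Ioc 0 (t * b)) :
    |t ^ p * (exp (-(t ^ 2 * φ (v / t))) * g (v / t))| ≤ C * (v ^ p * exp (-c * v ^ 2)) := by
  have hmem : v / t ∈ Ioc 0 b := ⟨div_pos hv.1 ht, (div_le_iff₀' ht).2 hv.2⟩
  have hphase : c * v ^ 2 ≤ t ^ 2 * φ (v / t) := by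
    calc c * v ^ 2 = t ^ 2 * (c * (v / t) ^ 2) := by field_simp
      _ ≤ t ^ 2 * φ (v / t) := by gcongr; exact hc _ hmem
  have hamplitude : t ^ p * |g (v / t)| ≤ C * v ^ p := by
    calc t ^ p * |g (v / t)| ≤ t ^ p * (C * (v / t) ^ p) := by gcongr; exact hC _ hmem
      _ = C * v ^ p := by
        rw [div_rpow hv.1.le ht.le]
        field_simp
  rw [abs_mul, abs_mul, abs_exp, abs_of_pos (rpow_pos_of_pos ht p)]
  calc t ^ p * (exp (-(t ^ 2 * φ (v / t))) * |g (v / t)|)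
      = exp (-(t ^ 2 * φ (v / t))) * (t ^ p * |g (v / t)|) := by ring
    _ ≤ exp (-c * v ^ 2) * (C * v ^ p) := by gcongr; linarith
    _ = C * (v ^ p * exp (-c * v ^ 2)) := by ring

theorem tendsto_rescaled_exp_neg_mul (hA : Tendsto (fun θ => φ θ / θ ^ 2) (𝓝[>] 0) (𝓝 A))
    (hB : Tendsto (fun θ => g θ / θ ^ p) (𝓝[>] 0) (𝓝 B)) {v : ℝ} (hv : 0 < v) :
    Tendsto (fun t => t ^ p * (exp (-(t ^ 2 * φ (v / t))) * g (v / t))) atTop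
      (𝓝 (B * (v ^ p * exp (-A * v ^ 2)))) := by
  have hscale : Tendsto (fun t => v / t) atTop (𝓝[>] 0) :=
    tendsto_nhdsWithin_iff.2 ⟨tendsto_const_nhds.div_atTop tendsto_id,
      (eventually_gt_atTop 0).mono fun t ht => div_pos hv ht⟩
  have hphase := (((hA.comp hscale).neg.mul_const (v ^ 2)).rexp).const_mul (v ^ p)
  rw [mul_comm B]
  refine ((hphase.mul (hB.comp hscale))).congr' ?_
  filter_upwards [eventually_gt_atTop 0] with t ht
  have hphase_eq : -(φ (v / t) / (v / t) ^ 2) * v ^ 2 = -(t ^ 2 * φ (v / t)) := by field_simp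
  have hvp : v ^ p ≠ 0 := (rpow_pos_of_pos hv p).ne'
  simp only [Function.comp_apply]
  rw [hphase_eq, div_rpow hv.le ht.le]
  field_simp

theorem tendsto_rpow_mul_integral_exp_neg_sq_mul (hp : -1 < p) (hb : 0 < b) (hc : 0 < c)
    (hφ : Measurable φ) (hg : Measurable g) (hcφ : ∀ θ ∈ Ioc 0 b, c * θ ^ 2 ≤ φ θ)
    (hgC : ∀ θ ∈ Ioc 0 b, |g θ| ≤ C * θ ^ p)
    (hA : Tendsto (fun θ => φ θ / θ ^ 2) (𝓝[>] 0) (𝓝 A))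
    (hB : Tendsto (fun θ => g θ / θ ^ p) (𝓝[>] 0) (𝓝 B)) :
    Tendsto (fun t => t ^ (p + 1) * ∫ θ in 0..b, exp (-(t ^ 2 * φ θ)) * g θ) atTop
      (𝓝 (∫ v in Ioi (0 : ℝ), B * (v ^ p * exp (-A * v ^ 2)))) := by
  refine Tendsto.congr' (f₁ := fun t => ∫ v in Ioi (0 : ℝ), (Ioc 0 (t * b)).indicator
    (fun v => t ^ p * (exp (-(t ^ 2 * φ (v / t))) * g (v / t))) v) ?_
    (tendsto_integral_filter_of_dominated_convergence
      (fun v => |C| * (v ^ p * exp (-c * v ^ 2))) (.of_forall fun t => ?_) ?_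
      ((integrableOn_rpow_mul_exp_neg_mul_sq hc hp).const_mul _) ?_)
  · filter_upwards [eventually_gt_atTop 0] with t ht
    exact (rpow_mul_intervalIntegral_eq_setIntegral_Ioi (fun θ => exp (-(t ^ 2 * φ θ)) * g θ) p
      hb.le ht).symm
  · exact (Measurable.indicator (by fun_prop) measurableSet_Ioc).aestronglyMeasurable
  · filter_upwards [eventually_gt_atTop 0] with t ht
    filter_upwards [ae_restrict_mem measurableSet_Ioi] with v hv
    have hv : 0 < v := hv
    by_cases hmem : v ∈ Ioc 0 (t * b)
    · rw [indicator_of_mem hmem]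
      refine (abs_rescaled_exp_neg_mul_le hcφ hgC ht hmem).trans ?_
      gcongr
      exact le_abs_self C
    · rw [indicator_of_notMem hmem, norm_zero]
      positivity
  · filter_upwards [ae_restrict_mem measurableSet_Ioi] with v hv
    refine (tendsto_rescaled_exp_neg_mul hA hB hv).congr' ?_
    filter_upwards [(tendsto_id.atTop_mul_const hb).eventually_ge_atTop v] with t ht
    rw [indicator_of_mem (show v ∈ Ioc 0 (t * b) from ⟨hv, ht⟩)]

theorem tendsto_rpow_mul_integral_exp_neg_mul (hp : -1 < p) (hb : 0 < b) (hc : 0 < c)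
    (hφ : Measurable φ) (hg : Measurable g) (hcφ : ∀ θ ∈ Ioc 0 b, c * θ ^ 2 ≤ φ θ)
    (hgC : ∀ θ ∈ Ioc 0 b, |g θ| ≤ C * θ ^ p)
    (hA : Tendsto (fun θ => φ θ / θ ^ 2) (𝓝[>] 0) (𝓝 A))
    (hB : Tendsto (fun θ => g θ / θ ^ p) (𝓝[>] 0) (𝓝 B)) :
    Tendsto (fun s => s ^ ((p + 1) / 2) * ∫ θ in 0..b, exp (-(s * φ θ)) * g θ) atTop
      (𝓝 (B * (A ^ (-((p + 1) / 2)) / 2 * Gamma ((p + 1) / 2)))) := by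
  have hA₀ : 0 < A := hc.trans_le <| ge_of_tendsto hA <| by
    filter_upwards [Ioc_mem_nhdsGT hb] with θ hθ
    exact (le_div_iff₀ (pow_pos hθ.1 2)).2 (hcφ θ hθ)
  have hlim := tendsto_rpow_mul_integral_exp_neg_sq_mul hp hb hc hφ hg hcφ hgC hA hB
  rw [integral_const_mul, integral_rpow_mul_exp_neg_mul_sq hA₀ hp] at hlim
  refine (hlim.comp tendsto_sqrt_atTop).congr' ?_
  filter_upwards [eventually_ge_atTop 0] with s hs
  rw [Function.comp_apply, sq_sqrt hs, sqrt_eq_rpow, ← rpow_mul hs, one_div_mul_eq_div]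

end LaplaceMethod

section LegendreAsymptotics

open Real Set Filter Topology Asymptotics

theorem isEquivalent_log_one_add : (fun y : ℝ => log (1 + y)) ~[𝓝 0] id := by
  have := (((hasDerivAt_id (0 : ℝ)).const_add 1).log (by simp)).isLittleO
  simpa [IsEquivalent, Function.id_def] using! this

theorem isEquivalent_one_sub_cos : (fun θ : ℝ => 1 - cos θ) ~[𝓝 0] fun θ => θ ^ 2 / 2 := by
  have hhalf : Tendsto (fun θ : ℝ => θ / 2) (𝓝 0) (𝓝 0) := by
    simpa using (continuous_id.div_const (2 : ℝ)).tendsto 0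
  have hsin := (IsEquivalent.refl (u := fun _ : ℝ => (2 : ℝ))).mul
    ((isEquivalent_sin.comp_tendsto hhalf).pow 2)
  refine (hsin.congr_left (.of_forall fun θ => ?_)).congr_right (.of_forall fun θ => ?_)
  · have hcos := cos_two_mul' (θ / 2)
    simp only [Pi.mul_apply, Pi.pow_apply, Function.comp_apply]
    rw [mul_div_cancel₀ _ (two_ne_zero' ℝ)] at hcos
    linear_combination sin_sq_add_cos_sq (θ / 2) + hcos
  · simp only [Pi.mul_apply, Pi.pow_apply, Function.comp_apply, id_eq]
    ring

theorem expBusemann_eq_exp_neg_mul (x θ : ℝ) :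
    expBusemann x θ = exp (-x) * (1 + exp x * sinh x * (1 - cos θ)) := by
  have hexp : exp (-x) * exp x = 1 := by rw [← exp_add, neg_add_cancel, exp_zero]
  rw [expBusemann]
  linear_combination (cosh_sub_sinh x) - sinh x * (1 - cos θ) * hexp

theorem log_expBusemann_add (x θ : ℝ) :
    log (expBusemann x θ) + x = log (1 + exp x * sinh x * (1 - cos θ)) := by
  have hpos := expBusemann_pos x θ
  rw [expBusemann_eq_exp_neg_mul] at hpos ⊢
  rw [log_mul (exp_pos _).ne' (pos_of_mul_pos_right hpos (exp_pos _).le).ne', log_exp]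
  ring

theorem tendsto_log_expBusemann_add_div_sq (x : ℝ) :
    Tendsto (fun θ => (log (expBusemann x θ) + x) / θ ^ 2) (𝓝[>] 0)
      (𝓝 (exp x * sinh x / 2)) := by
  have hzero : Tendsto (fun θ => exp x * sinh x * (1 - cos θ)) (𝓝 0) (𝓝 0) := by
    simpa using (continuous_const.mul (continuous_const.sub continuous_cos)).tendsto
      (f := fun θ => exp x * sinh x * (1 - cos θ)) 0
  have hphase : (fun θ => log (expBusemann x θ) + x) ~[𝓝 0]
      fun θ => exp x * sinh x * (θ ^ 2 / 2) := by
    simp only [log_expBusemann_add]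
    exact (isEquivalent_log_one_add.comp_tendsto hzero).trans
      (IsEquivalent.refl.mul isEquivalent_one_sub_cos)
  refine ((hphase.mono nhdsWithin_le_nhds).div
    (IsEquivalent.refl (u := fun θ : ℝ => θ ^ 2))).symm.tendsto_nhds ?_
  refine tendsto_const_nhds.congr' ?_
  filter_upwards [self_mem_nhdsWithin] with θ hθ
  have : θ ≠ 0 := (mem_Ioi.1 hθ).ne'
  simp only [Pi.div_apply]
  field_simp

theorem mul_sq_le_log_expBusemann_add {x θ : ℝ} (hx : 0 ≤ x) (hθ : |θ| ≤ π) :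
    exp x * sinh x / (1 + exp x * sinh x) * (2 / π ^ 2) * θ ^ 2 ≤
      log (expBusemann x θ) + x := by
  have ha : 0 ≤ exp x * sinh x := mul_nonneg (exp_pos x).le (sinh_nonneg_iff.2 hx)
  set a := exp x * sinh x
  have hcos := cos_le_one_sub_mul_cos_sq hθ
  have hle := neg_one_le_cos θ
  have h1 := cos_le_one θ
  have hy : 0 ≤ a * (1 - cos θ) := mul_nonneg ha (by linarith)
  rw [log_expBusemann_add]
  calc a / (1 + a) * (2 / π ^ 2) * θ ^ 2 = a / (1 + a) * (2 / π ^ 2 * θ ^ 2) := by ring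
    _ ≤ a / (1 + a) * (1 - cos θ) := by gcongr; linarith
    _ = 2 * (a * (1 - cos θ)) / (2 * a + 2) := by
      field_simp
      ring
    _ ≤ 2 * (a * (1 - cos θ)) / (a * (1 - cos θ) + 2) :=
      div_le_div_of_nonneg_left (by positivity) (by positivity) (by nlinarith)
    _ ≤ log (1 + a * (1 - cos θ)) := le_log_one_add_of_nonneg hy

theorem legendreIntegral_add_eq (n : ℕ) (β s x : ℝ) :
    legendreIntegral n (β + s) x = exp (x * s) *
      ∫ θ in 0..π, exp (-(s * (log (expBusemann x θ) + x))) *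
        (expBusemann x θ ^ (-β) * sin θ ^ n) := by
  rw [legendreIntegral, ← intervalIntegral.integral_const_mul]
  congr 1
  funext θ
  rw [← mul_assoc, ← mul_assoc, ← exp_add, rpow_def_of_pos (expBusemann_pos x θ),
    rpow_def_of_pos (expBusemann_pos x θ), ← exp_add]
  ring_nf

theorem tendsto_expBusemann_rpow_mul_sin_pow_div (n : ℕ) (β x : ℝ) :
    Tendsto (fun θ => expBusemann x θ ^ (-β) * sin θ ^ n / θ ^ (n : ℝ)) (𝓝[>] 0)
      (𝓝 (exp (x * β))) := by
  have hwave : Tendsto (fun θ => expBusemann x θ ^ (-β)) (𝓝[>] 0) (𝓝 (exp (x * β))) := by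
    have := (continuous_expBusemann_rpow_right (-β) x).tendsto 0
    rw [expBusemann, cos_zero, mul_one, cosh_sub_sinh, ← exp_mul, neg_mul_neg] at this
    exact this.mono_left nhdsWithin_le_nhds
  have hsin : Tendsto (fun θ : ℝ => (sin θ / θ) ^ n) (𝓝[>] 0) (𝓝 1) := by
    have := (continuous_sinc.pow n).tendsto 0
    rw [Pi.pow_apply, sinc_zero, one_pow] at this
    refine (this.mono_left nhdsWithin_le_nhds).congr' ?_
    filter_upwards [self_mem_nhdsWithin] with θ hθ
    rw [Pi.pow_apply, sinc_of_ne_zero (mem_Ioi.1 hθ).ne']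
  rw [← mul_one (exp _)]
  refine (hwave.mul hsin).congr fun θ => ?_
  rw [rpow_natCast, div_pow, mul_div_assoc]

theorem abs_expBusemann_rpow_mul_sin_pow_le (n : ℕ) {β x θ : ℝ} (hβ : 0 ≤ β) (hθ : 0 ≤ θ) :
    |expBusemann x θ ^ (-β) * sin θ ^ n| ≤ exp (|x| * β) * θ ^ (n : ℝ) := by
  have hwave : expBusemann x θ ^ (-β) ≤ exp (|x| * β) := by
    calc expBusemann x θ ^ (-β) ≤ exp (-|x|) ^ (-β) :=
          rpow_le_rpow_of_nonpos (exp_pos _) (exp_neg_abs_le_expBusemann x θ) (neg_nonpos.2 hβ)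
      _ = exp (|x| * β) := by rw [← exp_mul, neg_mul_neg]
  have hsin : |sin θ| ≤ θ := by simpa [abs_of_nonneg hθ] using abs_sin_le_abs (x := θ)
  rw [abs_mul, abs_pow, abs_of_pos (rpow_pos_of_pos (expBusemann_pos x θ) _), rpow_natCast]
  gcongr

theorem isEquivalent_legendreIntegral (n : ℕ) {x : ℝ} (hx : 0 < x) :
    (fun s => legendreIntegral n (((n : ℝ) + 1) / 2 + s) x) ~[atTop] fun s =>
      (2 / (s * sinh x)) ^ (((n : ℝ) + 1) / 2) * (Gamma (((n : ℝ) + 1) / 2) / 2) *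
        exp (x * s) := by
  set q : ℝ := ((n : ℝ) + 1) / 2 with hq_def
  have hq : 0 < q := by positivity
  have hsinh : 0 < sinh x := sinh_pos_iff.2 hx
  have hlaplace := tendsto_rpow_mul_integral_exp_neg_mul (p := n) (b := π)
    (φ := fun θ => log (expBusemann x θ) + x) (g := fun θ => expBusemann x θ ^ (-q) * sin θ ^ n)
    (by linarith [n.cast_nonneg (α := ℝ)]) pi_pos (by positivity) (by unfold expBusemann; fun_prop)
    (by unfold expBusemann; fun_prop)
    (fun θ hθ => mul_sq_le_log_expBusemann_add hx.le (abs_le.2 ⟨by linarith [hθ.1, pi_pos], hθ.2⟩))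
    (fun θ hθ => abs_expBusemann_rpow_mul_sin_pow_le n hq.le hθ.1.le)
    (tendsto_log_expBusemann_add_div_sq x) (tendsto_expBusemann_rpow_mul_sin_pow_div n q x)
  have hconst : exp (x * q) * ((exp x * sinh x / 2) ^ (-q) / 2 * Gamma q) =
      (2 / sinh x) ^ q * (Gamma q / 2) := by
    rw [rpow_neg (by positivity), div_rpow (by positivity) zero_le_two, mul_rpow (exp_pos x).le
      hsinh.le, ← exp_mul, div_rpow zero_le_two hsinh.le]
    field_simp
  rw [← hq_def, hconst, ← isEquivalent_const_iff_tendsto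
    (mul_pos (by positivity) (half_pos (Gamma_pos_of_pos hq))).ne'] at hlaplace
  refine ((hlaplace.mul (IsEquivalent.refl (u := fun s => s ^ (-q) * exp (x * s)))).congr_left
    ?_).congr_right ?_
  · filter_upwards [eventually_gt_atTop 0] with s hs
    simp only [Pi.mul_apply]
    rw [legendreIntegral_add_eq, rpow_neg hs.le]
    field_simp
  · filter_upwards [eventually_gt_atTop 0] with s hs
    simp only [Pi.mul_apply, Function.const_apply]
    rw [rpow_neg hs.le, mul_comm s, ← div_div, div_rpow (div_pos two_pos hsinh).le hs.le]
    ring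

end LegendreAsymptotics

section MainAsymptotics

open Real Set Filter Topology Asymptotics

theorem isEquivalent_sphereIntegral_atTop {n : ℕ} {ρ : ℝ} {m : EuclideanSpace ℝ (Fin (n + 2))}
    (hm₀ : m ≠ 0) (hm : ‖m‖ < ρ) :
    (fun s => sphereIntegral (n + 1) ρ m (((n : ℝ) + 1) / 2 + s)) ~[atTop] fun s =>
      (π * ρ * (ρ ^ 2 - ‖m‖ ^ 2) / (‖m‖ * |s|)) ^ (((n : ℝ) + 1) / 2) *
        ((ρ + ‖m‖) / (ρ - ‖m‖)) ^ |s| := by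
  set q : ℝ := ((n : ℝ) + 1) / 2 with hq_def
  set η := ‖m‖
  have hη : 0 < η := norm_pos_iff.2 hm₀
  have hρ : 0 < ρ := hη.trans hm
  have hsub : 0 < ρ - η := sub_pos.2 hm
  have hratio : 1 < (ρ + η) / (ρ - η) := (one_lt_div hsub).2 (by linarith)
  have hsinh : sinh (log ((ρ + η) / (ρ - η))) = 2 * ρ * η / (ρ ^ 2 - η ^ 2) := by
    rw [sinh_log (by linarith), show ρ ^ 2 - η ^ 2 = (ρ + η) * (ρ - η) by ring]
    field_simp
    ring
  have hpow : ρ ^ (n + 1) = (ρ ^ 2) ^ q := by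
    rw [← rpow_natCast ρ 2, ← rpow_mul hρ.le, ← rpow_natCast]
    congr 1
    push_cast
    ring
  have hdiff : 0 < ρ ^ 2 - η ^ 2 := by nlinarith
  have hL := isEquivalent_legendreIntegral n (log_pos hratio)
  simp only [sphereIntegral_eq_legendreIntegral hm₀ hm]
  refine (IsEquivalent.refl.mul (IsEquivalent.refl.mul hL)).congr_right ?_
  filter_upwards [eventually_gt_atTop 0] with s hs
  have hΓ : Gamma q ≠ 0 := (Gamma_pos_of_pos (by positivity)).ne'
  have hbase : π * ρ * (ρ ^ 2 - η ^ 2) / (η * s) =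
      ρ ^ 2 * (π * (2 / (s * (2 * ρ * η / (ρ ^ 2 - η ^ 2))))) := by
    field_simp
  simp only [Pi.mul_apply]
  rw [abs_of_pos hs, rpow_def_of_pos (by positivity : 0 < (ρ + η) / (ρ - η)), hsinh, hbase,
    mul_rpow (by positivity) (by positivity), mul_rpow (by positivity) (by positivity), hpow,
    toSphere_real_univ_euclideanSpace, Fintype.card_fin, Nat.cast_add_one, ← hq_def]
  field_simp

theorem sphereIntegral_neg {n : ℕ} {ρ : ℝ} {m : EuclideanSpace ℝ (Fin (n + 2))}
    (hm₀ : m ≠ 0) (hm : ‖m‖ < ρ) (s : ℝ) :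
    sphereIntegral (n + 1) ρ m (((n : ℝ) + 1) / 2 + -s) =
      sphereIntegral (n + 1) ρ m (((n : ℝ) + 1) / 2 + s) := by
  have hlog : 0 ≤ log ((ρ + ‖m‖) / (ρ - ‖m‖)) :=
    log_nonneg ((one_le_div (sub_pos.2 hm)).2 (by linarith [norm_nonneg m]))
  rw [sphereIntegral_eq_legendreIntegral hm₀ hm, sphereIntegral_eq_legendreIntegral hm₀ hm,
    ← legendreIntegral_symm n _ hlog]
  ring_nf

theorem isEquivalent_sphereIntegral_atBot {n : ℕ} {ρ : ℝ} {m : EuclideanSpace ℝ (Fin (n + 2))}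
    (hm₀ : m ≠ 0) (hm : ‖m‖ < ρ) :
    (fun s => sphereIntegral (n + 1) ρ m (((n : ℝ) + 1) / 2 + s)) ~[atBot] fun s =>
      (π * ρ * (ρ ^ 2 - ‖m‖ ^ 2) / (‖m‖ * |s|)) ^ (((n : ℝ) + 1) / 2) *
        ((ρ + ‖m‖) / (ρ - ‖m‖)) ^ |s| := by
  simpa only [Function.comp_def, abs_neg, sphereIntegral_neg hm₀ hm] using
    (isEquivalent_sphereIntegral_atTop hm₀ hm).comp_tendsto tendsto_neg_atBot_atTop

/-- The `s ≥ 0` for which `(n + 1) / 2 ± s` are the two exponents `α` of the waves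
`expBusemann ^ (-α)` with eigenvalue `lam`, in curvature `-1 / ρ ^ 2`. Meaningful when the radicand
is nonnegative, in particular for `lam ≤ 0`. -/
noncomputable def spectralParameter (n : ℕ) (ρ lam : ℝ) : ℝ :=
  √((((n : ℝ) + 1) / 2) ^ 2 - lam * ρ ^ 2)

theorem sq_spectralParameter (n : ℕ) (ρ : ℝ) {lam : ℝ} (hlam : lam ≤ 0) :
    spectralParameter n ρ lam ^ 2 = (((n : ℝ) + 1) / 2) ^ 2 - lam * ρ ^ 2 :=
  sq_sqrt (by nlinarith [mul_nonneg (neg_nonneg.2 hlam) (sq_nonneg ρ)])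

theorem eigenvalue_spectralParameter (n : ℕ) (ρ : ℝ) {lam : ℝ} (hlam : lam ≤ 0) :
    (((n : ℝ) + 1) / 2 + spectralParameter n ρ lam) *
      (n + 1 - (((n : ℝ) + 1) / 2 + spectralParameter n ρ lam)) = lam * ρ ^ 2 := by
  linear_combination -sq_spectralParameter n ρ hlam

theorem tendsto_mul_sqrt_neg_atBot {ρ : ℝ} (hρ : 0 < ρ) :
    Tendsto (fun lam => ρ * √(-lam)) atBot atTop :=
  (tendsto_sqrt_atTop.comp tendsto_neg_atBot_atTop).const_mul_atTop hρ

theorem tendsto_spectralParameter_sub (n : ℕ) {ρ : ℝ} (hρ : 0 < ρ) :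
    Tendsto (fun lam => spectralParameter n ρ lam - ρ * √(-lam)) atBot (𝓝 0) := by
  have hsum : Tendsto (fun lam => spectralParameter n ρ lam + ρ * √(-lam)) atBot atTop :=
    tendsto_atTop_mono (fun _ => le_add_of_nonneg_left (sqrt_nonneg _))
      (tendsto_mul_sqrt_neg_atBot hρ)
  refine (tendsto_const_nhds (x := (((n : ℝ) + 1) / 2) ^ 2)).div_atTop hsum |>.congr' ?_
  filter_upwards [hsum.eventually_gt_atTop 0, eventually_le_atBot 0] with lam hpos hlam
  rw [div_eq_iff hpos.ne']
  linear_combination ρ ^ 2 * sq_sqrt (neg_nonneg.2 hlam) - sq_spectralParameter n ρ hlam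

theorem isEquivalent_spectralParameter (n : ℕ) {ρ : ℝ} (hρ : 0 < ρ) :
    spectralParameter n ρ ~[atBot] fun lam => ρ * √(-lam) :=
  ((isLittleO_one_iff ℝ).2 (tendsto_spectralParameter_sub n hρ)).trans_isBigO
    ((isLittleO_const_left.2 (.inr (tendsto_norm_atTop_atTop.comp
      (tendsto_mul_sqrt_neg_atBot hρ)))).isBigO)

theorem isEquivalent_exp_of_tendsto_sub {ι : Type*} {l : Filter ι} {f g : ι → ℝ}
    (h : Tendsto (fun i => f i - g i) l (𝓝 0)) :
    (fun i => exp (f i)) ~[l] fun i => exp (g i) := by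
  refine isEquivalent_of_tendsto_one ?_
  simpa [Pi.div_def, ← exp_sub] using h.rexp

theorem isEquivalent_legendreIntegral_spectralParameter (n : ℕ) {ρ r : ℝ} (hρ : 0 < ρ)
    (hr : 0 < r) :
    (fun lam => legendreIntegral n (((n : ℝ) + 1) / 2 + spectralParameter n ρ lam) (r / ρ))
      ~[atBot] fun lam => (2 / (ρ * √(-lam) * sinh (r / ρ))) ^ (((n : ℝ) + 1) / 2) *
        (Gamma (((n : ℝ) + 1) / 2) / 2) * exp (r * √(-lam)) := by
  have hS := isEquivalent_spectralParameter n hρ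
  have hamplitude : (fun lam => (2 / (spectralParameter n ρ lam * sinh (r / ρ))) ^
      (((n : ℝ) + 1) / 2)) ~[atBot]
      fun lam => (2 / (ρ * √(-lam) * sinh (r / ρ))) ^ (((n : ℝ) + 1) / 2) :=
    IsEquivalent.rpow
      (fun lam => show 0 ≤ 2 / (ρ * √(-lam) * sinh (r / ρ)) by positivity)
      (IsEquivalent.refl.div (hS.mul IsEquivalent.refl))
  have hwave : (fun lam => exp (r / ρ * spectralParameter n ρ lam)) ~[atBot]
      fun lam => exp (r * √(-lam)) := by
    refine isEquivalent_exp_of_tendsto_sub ?_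
    rw [← mul_zero (r / ρ)]
    refine ((tendsto_spectralParameter_sub n hρ).const_mul (r / ρ)).congr fun lam => ?_
    field_simp
  exact ((isEquivalent_legendreIntegral n (div_pos hr hρ)).comp_tendsto
    (hS.symm.tendsto_atTop (tendsto_mul_sqrt_neg_atBot hρ))).trans
    ((hamplitude.mul IsEquivalent.refl).mul hwave)

theorem IsRadialEigenfunction.isEquivalent_atBot {n : ℕ} {ρ : ℝ} (hρ : 0 < ρ) {φ : ℝ → ℝ → ℝ}
    (hφ : ∀ᶠ lam in atBot, IsRadialEigenfunction (n + 1) ρ lam (φ lam)) {r : ℝ} (hr : 0 < r) :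
    (fun lam => φ lam r) ~[atBot] fun lam =>
      (2 / ρ) ^ (((n : ℝ) + 1) / 2) *
        (Gamma (((n : ℝ) + 2) / 2) / (2 * √π * sinh (r / ρ) ^ (((n : ℝ) + 1) / 2))) *
        (exp (r * √(-lam)) / (-lam) ^ (((n : ℝ) + 1) / 4)) := by
  have hsinh : 0 < sinh (r / ρ) := sinh_pos_iff.2 (div_pos hr hρ)
  refine (((isEquivalent_legendreIntegral_spectralParameter n hρ hr).div (IsEquivalent.refl
    (u := fun _ => √π * Gamma (((n : ℝ) + 1) / 2) / Gamma (((n : ℝ) + 2) / 2)))).congr_left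
    ?_).congr_right ?_
  · filter_upwards [hφ, eventually_le_atBot 0] with lam hφ hlam
    have heq := hφ.eqOn_legendreIntegral hρ (eigenvalue_spectralParameter n ρ hlam) hr.le
    simpa only [Pi.div_apply, legendreIntegral_zero] using heq.symm
  · filter_upwards [eventually_lt_atBot 0] with lam hlam
    have hneg : 0 < -lam := neg_pos.2 hlam
    have hΓ₁ : Gamma (((n : ℝ) + 1) / 2) ≠ 0 := (Gamma_pos_of_pos (by positivity)).ne'
    have hΓ₂ : Gamma (((n : ℝ) + 2) / 2) ≠ 0 := (Gamma_pos_of_pos (by positivity)).ne'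
    have hsqrt : √(-lam) ^ (((n : ℝ) + 1) / 2) = (-lam) ^ (((n : ℝ) + 1) / 4) := by
      rw [sqrt_eq_rpow, ← rpow_mul hneg.le]
      ring_nf
    simp only [Pi.div_apply]
    rw [div_rpow zero_le_two (by positivity), mul_rpow (by positivity) hsinh.le,
      mul_rpow hρ.le (by positivity), hsqrt, div_rpow zero_le_two hρ.le]
    field_simp

theorem exists_isRadialEigenfunction_forall_eqOn (n : ℕ) {ρ lam : ℝ} (hρ : 0 < ρ)
    (hlam : lam ≤ 0) :
    ∃ φ, IsRadialEigenfunction (n + 1) ρ lam φ ∧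
      ∀ ψ, IsRadialEigenfunction (n + 1) ρ lam ψ → EqOn ψ φ (Ici 0) :=
  have hα := eigenvalue_spectralParameter n ρ hlam
  ⟨_, isRadialEigenfunction_legendreIntegral hρ.ne' hα, fun _ hψ =>
    hψ.eqOn_legendreIntegral hρ hα⟩

end MainAsymptotics

theorem mainTheorem9 (k : ℕ) (hk : 1 ≤ k) (ρ : ℝ) (hρ : 0 < ρ) :
    -- first form: the asymptotics of `F(k/2 + s)` as `s → ±∞`, where `η = |m|`
    (∀ (m : EuclideanSpace ℝ (Fin (k + 1))) (η : ℝ), ‖m‖ = η → 0 < η → η < ρ →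
      Asymptotics.IsEquivalent Filter.atTop
        (fun s : ℝ => sphereIntegral k ρ m ((k : ℝ) / 2 + s))
        (fun s : ℝ => (Real.pi * ρ * (ρ ^ 2 - η ^ 2) / (η * |s|)) ^ ((k : ℝ) / 2)
          * ((ρ + η) / (ρ - η)) ^ |s|) ∧
      Asymptotics.IsEquivalent Filter.atBot
        (fun s : ℝ => sphereIntegral k ρ m ((k : ℝ) / 2 + s))
        (fun s : ℝ => (Real.pi * ρ * (ρ ^ 2 - η ^ 2) / (η * |s|)) ^ ((k : ℝ) / 2)
          * ((ρ + η) / (ρ - η)) ^ |s|)) ∧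
    -- `φ_lam` is well defined for `lam < 0`
    (∀ lam : ℝ, lam < 0 → ∃ φ : ℝ → ℝ, IsRadialEigenfunction k ρ lam φ ∧
      ∀ ψ : ℝ → ℝ, IsRadialEigenfunction k ρ lam ψ → Set.EqOn ψ φ (Set.Ici 0)) ∧
    -- second form: the asymptotics of `φ_lam(r)` as `lam → -∞` with `r` fixed
    (∀ φ : ℝ → ℝ → ℝ, (∀ᶠ lam in Filter.atBot, IsRadialEigenfunction k ρ lam (φ lam)) →
      ∀ r : ℝ, 0 < r →
      Asymptotics.IsEquivalent Filter.atBot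
        (fun lam : ℝ => φ lam r)
        (fun lam : ℝ => (2 / ρ) ^ ((k : ℝ) / 2)
          * (Real.Gamma (((k : ℝ) + 1) / 2)
              / (2 * Real.sqrt Real.pi * Real.sinh (r / ρ) ^ ((k : ℝ) / 2)))
          * (Real.exp (r * Real.sqrt (-lam)) / (-lam) ^ ((k : ℝ) / 4)))) := by
  obtain ⟨n, rfl⟩ := Nat.exists_eq_add_of_le' hk
  push_cast
  refine ⟨?_, fun lam hlam => exists_isRadialEigenfunction_forall_eqOn n hρ hlam.le, ?_⟩
  · rintro m _ rfl hm₀ hm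
    exact ⟨isEquivalent_sphereIntegral_atTop (norm_pos_iff.1 hm₀) hm,
      isEquivalent_sphereIntegral_atBot (norm_pos_iff.1 hm₀) hm⟩
  · intro φ hφ r hr
    simpa only [add_assoc, one_add_one_eq_two] using
      IsRadialEigenfunction.isEquivalent_atBot hρ hφ hr
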